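/- Let $M$ be a compact metric space with distance $\rho$ (a finite space is allowed), on which a group $G$ acts by isometries, such that whenever $\rho(x,y)=\rho(x',y')$ there is $g\in G$ with $g(x)=x'$ and $g(y)=y'$ (a 2-point-homogeneous space). Let $\mu$ be the $G$-invariant Borel probability measure on $M$. Let $\tau(x,y)=F(\rho(x,y))$ for a function $F:\mathbb R\to\mathbb R$, let $\tau_0=\tau(x,x)=F(0)$ and $T=\{\tau(x,y):x,y\in M\}$, and let $J=\{k\in\mathbb Z_{\ge 0}: k<|T|\}$ (so $J=\{0,1,2,\dots\}$ if $T$ is infinite). Suppose that the zonal spherical functions of $M$ are polynomials $\Phi_k(t)=\sum_{i=0}^k p_{ki}t^i$ of degree $k$, $k\in J$. That is: $L^2(M,\mu)$ is the orthogonal Hilbert sum of finite-dimensional irreducible $G$-invariant spaces $V_k$ ($k\in J$) of continuous complex-valued functions, and for each $k\in J$ and $y\in M$ the function $x\mapsto\Phi_k(\tau(x,y))$ belongs to $V_k$, with the normalization $\Phi_k(\tau_0)=1$. Let $a,b\in\mathbb R$ and $S=T\cap[a,b]$. A finite set $C\subset M$ is an $S$-code if $\tau(x,y)\in S$ for all distinct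 $x,y\in C$; $A(M,S)$ denotes the largest cardinality of an $S$-code. Fix an integer $m\ge 1$. For real numbers $x_1,\dots,x_{2m-1}$ put $x_0=1$, and let $\bar H_m(x_1,\dots,x_{2m-1},[a,b])$ be the block diagonal matrix with the three $m\times m$ blocks $$(x_{i+j})_{0\le i,j<m},\qquad (x_{i+j+1}-a\,x_{i+j})_{0\le i,j<m},\qquad (b\,x_{i+j}-x_{i+j+1})_{0\le i,j<m}.$$ Consider the semidefinite program $SDP_0$: minimize $y$ over real numbers $y,x_1,\dots,x_{2m-1}$ subject to $$y+\sum_{i=1}^k p_{ki}x_i\ \ge\ -p_{k0}\quad (1\le k\le 2m-1,\ k\in J),\qquad \bar H_m(x_1,\dots,x_{2m-1},[a,b])\succeq 0 .$$ **Theorem.** If $y^*$ is the optimal value (the infimum of $y$) of $SDP_0$ and $y^*>0$, then $A(M,S)$ is finite and $$A(M,S)\ \le\ \frac{1+y^*}{y^*}.$$ -/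

import Mathlib

open MeasureTheory Polynomial
open scoped ENNReal

noncomputable section

namespace ZonalSDP

/-- The group `G`, acting on the metric space `M` by isometries, makes `M` a
2-point-homogeneous space: equidistant pairs of points are carried to each other by `G`. -/
def TwoPointHomogeneous (G M : Type*) [MetricSpace M] [Group G] [MulAction G M]
    [IsIsometricSMul G M] : Prop :=
  ∀ x y x' y' : M, dist x y = dist x' y' → ∃ g : G, g • x = x' ∧ g • y = y'

section Space

variable {M : Type*} [MetricSpace M]

/-- The function `τ(x, y) = F(ρ(x, y))` of the distance. -/
def tau (F : ℝ → ℝ) (x y : M) : ℝ := F (dist x y)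

/-- The set `T` of all values `τ(x, y)`. -/
def tauSet (M : Type*) [MetricSpace M] (F : ℝ → ℝ) : Set ℝ :=
  {t | ∃ x y : M, tau F x y = t}

/-- The indices `k = 0, 1, 2, …` of the zonal spherical functions: there are as many of them as
elements of `T`, so all `k` occur if `T` is infinite, and `0 ≤ k < |T|` if `T` is finite. -/
def zonalIndex (M : Type*) [MetricSpace M] (F : ℝ → ℝ) : Set ℕ :=
  {k | (k : ℕ∞) < (tauSet M F).encard}

/-- A finite subset `C` is an `S`-code if `τ(x, y) ∈ S` for all distinct `x, y ∈ C`. -/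
def IsCode (F : ℝ → ℝ) (S : Set ℝ) (C : Finset M) : Prop :=
  ∀ x ∈ C, ∀ y ∈ C, x ≠ y → tau F x y ∈ S

/-- `A(M, S)`, the largest cardinality of an `S`-code (`⊤` if these are unbounded). -/
def maxCode (M : Type*) [MetricSpace M] (F : ℝ → ℝ) (S : Set ℝ) : ℕ∞ :=
  ⨆ (C : Finset M) (_ : IsCode F S C), (C.card : ℕ∞)

/-- `V` is invariant under the translations `f ↦ f(g⁻¹ ·)`, `g ∈ G`. -/
def InvariantSubspace (G : Type*) [Group G] [MulAction G M] (V : Submodule ℂ C(M, ℂ)) : Prop :=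
  ∀ (g : G), ∀ f ∈ V, ∃ f' ∈ V, ∀ x : M, f' x = f (g⁻¹ • x)

/-- `V` is a nonzero invariant subspace without proper nonzero invariant subspaces. -/
def IrreducibleSubspace (G : Type*) [Group G] [MulAction G M] (V : Submodule ℂ C(M, ℂ)) : Prop :=
  InvariantSubspace G V ∧ V ≠ ⊥ ∧
    ∀ W : Submodule ℂ C(M, ℂ), W ≤ V → InvariantSubspace G W → W = ⊥ ∨ W = V

/-- `Φ k`, for `k` in the index set, are the zonal spherical functions of `M`: the space
`L²(M, μ)` is the orthogonal Hilbert sum of finite-dimensional irreducible `G`-invariant spaces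
`V k` of continuous functions, and for each point `y` the function `x ↦ Φ k (τ(x, y))` is the
element of `V k` which depends only on the distance to `y` and takes the value `1` at `y`. -/
def IsZonalFamily (G : Type*) [CompactSpace M] [MeasurableSpace M] [BorelSpace M]
    [Group G] [MulAction G M] (μ : Measure M) [IsFiniteMeasure μ]
    (F : ℝ → ℝ) (Φ : ℕ → ℝ → ℝ) : Prop :=
  ∃ V : ℕ → Submodule ℂ C(M, ℂ),
    (∀ k ∈ zonalIndex M F, FiniteDimensional ℂ (V k) ∧ IrreducibleSubspace G (V k)) ∧
    (∀ k ∈ zonalIndex M F, ∀ l ∈ zonalIndex M F, k ≠ l → ∀ f ∈ V k, ∀ f' ∈ V l,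
      ∫ x, f x * starRingEnd ℂ (f' x) ∂μ = 0) ∧
    (⨆ k ∈ zonalIndex M F,
      (V k).map (ContinuousMap.toLp 2 μ ℂ).toLinearMap).topologicalClosure = ⊤ ∧
    (∀ k ∈ zonalIndex M F, ∀ y : M, ∃ f ∈ V k, ∀ x : M, f x = ((Φ k (tau F x y) : ℝ) : ℂ)) ∧
    (∀ k ∈ zonalIndex M F, Φ k (F 0) = 1)

end Space

section Sylvester

/-- The Hankel matrix `R_m = (s_{i+j})`, `0 ≤ i, j < m`. -/
def hankelR (m : ℕ) (s : ℕ → ℝ) : Matrix (Fin m) (Fin m) ℝ :=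
  Matrix.of fun i j => s (i + j)

/-- `F_m⁺(a) = (s_{i+j+1} - a s_{i+j})`. -/
def hankelPlus (m : ℕ) (s : ℕ → ℝ) (a : ℝ) : Matrix (Fin m) (Fin m) ℝ :=
  Matrix.of fun i j => s (i + j + 1) - a * s (i + j)

/-- `F_m⁻(b) = (b s_{i+j} - s_{i+j+1})`. -/
def hankelMinus (m : ℕ) (s : ℕ → ℝ) (b : ℝ) : Matrix (Fin m) (Fin m) ℝ :=
  Matrix.of fun i j => b * s (i + j) - s (i + j + 1)

/-- The block diagonal matrix `H_m(s_0, …, s_{2m-1}, [a, b])` with blocks `R_m`, `F_m⁺(a)`,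
`F_m⁻(b)`. -/
def sylvesterH (m : ℕ) (s : ℕ → ℝ) (a b : ℝ) :
    Matrix (Fin m ⊕ (Fin m ⊕ Fin m)) (Fin m ⊕ (Fin m ⊕ Fin m)) ℝ :=
  Matrix.fromBlocks (hankelR m s) 0 0
    (Matrix.fromBlocks (hankelPlus m s a) 0 0 (hankelMinus m s b))

/-- The sequence `1, x_1, …, x_{2m-1}` (continued by `0`); the variable `x_d` is stored at
position `d - 1`. -/
def powerSums {m : ℕ} (x : Fin (2 * m - 1) → ℝ) (d : ℕ) : ℝ :=
  if d = 0 then 1 else if h : d - 1 < 2 * m - 1 then x ⟨d - 1, h⟩ else 0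

/-- The point `(y, x_1, …, x_{2m-1})` is feasible for the problem `SDP₀`; `J` is the index set of
the polynomials `Φ_k = ∑ i, p_{ki} t^i`. -/
def SDP0Feasible (J : Set ℕ) (Φ : ℕ → ℝ[X]) (a b : ℝ) (m : ℕ) (y : ℝ)
    (x : Fin (2 * m - 1) → ℝ) : Prop :=
  (∀ k ∈ Finset.Icc 1 (2 * m - 1), k ∈ J →
    y + ∑ i ∈ Finset.Icc 1 k, (Φ k).coeff i * powerSums x i ≥ -(Φ k).coeff 0) ∧
  (sylvesterH m (powerSums x) a b).PosSemidef

/-- The values of the objective function `y` of `SDP₀` at its feasible points. -/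
def SDP0Values (J : Set ℕ) (Φ : ℕ → ℝ[X]) (a b : ℝ) (m : ℕ) : Set ℝ :=
  {y | ∃ x : Fin (2 * m - 1) → ℝ, SDP0Feasible J Φ a b m y x}

end Sylvester

end ZonalSDP

end

namespace ZonalSDP

/-! For a code of `N ≥ 2` points, let `x_d` be the average of `τ ^ d` over the `N(N-1)` ordered
pairs of distinct points. These are moments of a probability measure on `[a, b]`, so the Hankel
blocks are positive semidefinite (`posSemidef_sylvesterH_of_weights`). Since `Φ_k(τ)` is a positive
semidefinite kernel with diagonal `1`, its off-diagonal sum is at least `-N`; hence `y = N /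
(N(N-1)) = 1/(N-1)` is feasible, and `y* ≤ 1/(N-1)` is the bound.

Positivity (`sum_zonal_nonneg`) is a Schur argument: integration against `φ(ρ(x,y))` maps `V_k` to
itself and commutes with `G`, hence is a scalar `c`. Applied to the zonal functions this says `φ * φ
= c φ`, with `c = ∫ φ² > 0`, so `c ∑ φ(ρ(x,z))` over pairs from `C` is the integral of a square. -/

/-- Functionals without common nonzero kernel vector span the dual space. -/
theorem span_dual_eq_top_of_separating {K E : Type*} [Field K] [AddCommGroup E] [Module K E]
    [FiniteDimensional K E] (s : Set (Module.Dual K E))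
    (hs : ∀ v : E, (∀ f ∈ s, f v = 0) → v = 0) : Submodule.span K s = ⊤ := by
  rw [← Subspace.dualCoannihilator_dualAnnihilator_eq (W := Submodule.span K s)]
  have : (Submodule.span K s).dualCoannihilator = ⊥ := by
    rw [eq_bot_iff]
    intro v hv
    rw [Submodule.mem_dualCoannihilator] at hv
    exact hs v fun f hf => hv f (Submodule.subset_span hf)
  rw [this, Submodule.dualAnnihilator_bot]

/-! ### Positivity of zonal kernels. -/

section Kernel

variable {M G : Type*} [MetricSpace M]

/-- Functionals applied to a symmetric kernel with sections in `V` give elements of `V`. -/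
theorem exists_mem_eq_dual_apply [CompactSpace M] (V : Submodule ℂ C(M, ℂ)) [FiniteDimensional ℂ V]
    (Z : M → V) (hsymm : ∀ x y, (Z x : C(M, ℂ)) y = (Z y : C(M, ℂ)) x)
    (ψ : Module.Dual ℂ V) : ∃ v : V, ∀ x, (v : C(M, ℂ)) x = ψ (Z x) := by
  let ev : M → Module.Dual ℂ V := fun x =>
    { toFun := fun v => (v : C(M, ℂ)) x
      map_add' := fun _ _ => rfl
      map_smul' := fun _ _ => rfl }
  -- Point evaluations separate `V`, so they span its dual; for evaluation at `z` the vector is `Z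
  -- z`, by symmetry.
  have hψ : ψ ∈ Submodule.span ℂ (Set.range ev) := by
    have htop : Submodule.span ℂ (Set.range ev) = ⊤ :=
      span_dual_eq_top_of_separating _ fun v hv =>
        Subtype.ext (ContinuousMap.ext fun x => hv (ev x) ⟨x, rfl⟩)
    exact htop ▸ Submodule.mem_top
  induction hψ using Submodule.span_induction with
  | mem ψ h =>
    obtain ⟨z, rfl⟩ := h
    exact ⟨Z z, fun x => hsymm z x⟩
  | zero => exact ⟨0, fun x => rfl⟩
  | add ψ₁ ψ₂ _ _ h₁ h₂ =>
    obtain ⟨v₁, h₁⟩ := h₁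
    obtain ⟨v₂, h₂⟩ := h₂
    exact ⟨v₁ + v₂, fun x => by simp [← h₁, ← h₂]⟩
  | smul c ψ _ h =>
    obtain ⟨v, h⟩ := h
    exact ⟨c • v, fun x => by simp [← h]⟩

variable [CompactSpace M] [MeasurableSpace M] [Group G] [MulAction G M]

/-- An invariant probability measure on a compact homogeneous space charges open sets. -/
theorem isOpenPosMeasure_of_twoPointHomogeneous [IsIsometricSMul G M]
    (hM : TwoPointHomogeneous G M) (μ : Measure M) [IsProbabilityMeasure μ]
    [SMulInvariantMeasure G M μ] : μ.IsOpenPosMeasure := by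
  have : MulAction.IsPretransitive G M := ⟨fun x y => by
    obtain ⟨g, hg, -⟩ := hM x x y y (by simp)
    exact ⟨g, hg⟩⟩
  exact ⟨fun U hU hne => (measure_isOpen_pos_of_smulInvariant_of_compact_ne_zero G
    isCompact_univ (by simp) hU hne).ne'⟩

variable [BorelSpace M]

theorem integrable_of_continuous {E : Type*} [NormedAddCommGroup E] (μ : Measure M)
    [IsFiniteMeasure μ] {f : M → E} (hf : Continuous f) : Integrable f μ :=
  hf.integrable_of_hasCompactSupport (HasCompactSupport.of_compactSpace f)

/-- Integration against a symmetric invariant kernel is a scalar on an irreducible space which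
contains the sections of the kernel. -/
theorem exists_integral_kernel_eq_mul [ContinuousConstSMul G M] (μ : Measure M)
    [IsFiniteMeasure μ] [SMulInvariantMeasure G M μ] {V : Submodule ℂ C(M, ℂ)}
    [FiniteDimensional ℂ V] (hV : IrreducibleSubspace G V) (Z : M → V)
    (hsymm : ∀ x y, (Z x : C(M, ℂ)) y = (Z y : C(M, ℂ)) x)
    (hinv : ∀ (g : G) x y, (Z (g • x) : C(M, ℂ)) (g • y) = (Z x : C(M, ℂ)) y) :
    ∃ c : ℂ, ∀ f ∈ V, ∀ x, ∫ y, (Z x : C(M, ℂ)) y * f y ∂μ = c * f x := by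
  have hint : ∀ f g : C(M, ℂ), Integrable (fun y => f y * g y) μ := fun f g =>
    integrable_of_continuous μ (f.continuous.mul g.continuous)
  let ψ : V → Module.Dual ℂ V := fun f =>
    { toFun := fun v => ∫ y, (v : C(M, ℂ)) y * (f : C(M, ℂ)) y ∂μ
      map_add' := fun v w => by
        rw [← integral_add (hint _ _) (hint _ _)]
        simp [add_mul]
      map_smul' := fun c v => by
        rw [RingHom.id_apply, smul_eq_mul, ← integral_const_mul]
        simp [mul_assoc] }
  -- `K f` is the integral operator applied to `f`; its values lie in `V`, so it has an eigenvalue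
  -- there.
  choose K hK using fun f => exists_mem_eq_dual_apply V Z hsymm (ψ f)
  have hK' : ∀ f x, (K f : C(M, ℂ)) x = ∫ y, (Z x : C(M, ℂ)) y * (f : C(M, ℂ)) y ∂μ := hK
  let T : Module.End ℂ V :=
    { toFun := K
      map_add' := fun f g => by
        ext x
        simp only [Submodule.coe_add, ContinuousMap.add_apply, hK', mul_add]
        exact integral_add (hint _ _) (hint _ _)
      map_smul' := fun c f => by
        ext x
        simp only [RingHom.id_apply, Submodule.coe_smul, ContinuousMap.smul_apply, hK',
          smul_eq_mul, ← integral_const_mul]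
        congr 1
        ext y
        ring }
  obtain ⟨hVinv, hVne, hVirr⟩ := hV
  have : Nontrivial V := (Submodule.nontrivial_iff_ne_bot).2 hVne
  obtain ⟨c, hc⟩ := Module.End.exists_eigenvalue T
  obtain ⟨v, hv⟩ := hc.exists_hasEigenvector
  let W : Submodule ℂ C(M, ℂ) := (Module.End.eigenspace T c).map V.subtype
  have hmem : ∀ f, f ∈ W ↔ f ∈ V ∧ ∀ x, ∫ y, (Z x : C(M, ℂ)) y * f y ∂μ = c * f x := by
    intro f
    constructor
    · rintro ⟨f, hf, rfl⟩
      refine ⟨f.2, fun x => ?_⟩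
      have h := Module.End.mem_eigenspace_iff.1 hf
      have h' := congrArg (fun u : V => (u : C(M, ℂ)) x) h
      exact (hK' f x).symm.trans h'
    · rintro ⟨hf, h⟩
      refine ⟨⟨f, hf⟩, Module.End.mem_eigenspace_iff.2 ?_, rfl⟩
      ext x
      exact (hK' ⟨f, hf⟩ x).trans (h x)
  -- Invariance of both `μ` and the kernel makes the operator commute with translations.
  have hW : InvariantSubspace G W := by
    intro g f hf
    obtain ⟨hfV, hf⟩ := (hmem f).1 hf
    obtain ⟨f', hf'V, hf'⟩ := hVinv g f hfV
    refine ⟨f', (hmem f').2 ⟨hf'V, fun x => ?_⟩, hf'⟩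
    rw [hf', ← hf, ← integral_smul_eq_self (μ := μ) _ (g := g)]
    congr 1
    ext y
    rw [hf', inv_smul_smul, ← hinv g (g⁻¹ • x) y, smul_inv_smul]
  have hWV : W = V := by
    refine (hVirr W (fun f hf => ((hmem f).1 hf).1) hW).resolve_left fun h => ?_
    have hvW : (v : C(M, ℂ)) ∈ W := ⟨v, hv.1, rfl⟩
    rw [h, Submodule.mem_bot] at hvW
    exact hv.2 (Subtype.ext hvW)
  exact ⟨c, fun f hf => ((hmem f).1 (hWV ▸ hf)).2⟩

/-- A zonal spherical function, as a kernel on `M`, is positive semidefinite. -/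
theorem sum_zonal_nonneg [IsIsometricSMul G M] (hM : TwoPointHomogeneous G M) (μ : Measure M)
    [IsProbabilityMeasure μ] [SMulInvariantMeasure G M μ] {V : Submodule ℂ C(M, ℂ)}
    [FiniteDimensional ℂ V] (hV : IrreducibleSubspace G V) (φ : ℝ → ℝ) (h0 : φ 0 = 1)
    (hφ : ∀ y : M, ∃ f ∈ V, ∀ x : M, f x = ((φ (dist x y) : ℝ) : ℂ)) (C : Finset M) :
    0 ≤ ∑ x ∈ C, ∑ y ∈ C, φ (dist x y) := by
  have := isOpenPosMeasure_of_twoPointHomogeneous hM μ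
  choose f hfV hf using hφ
  obtain ⟨c, hc⟩ := exists_integral_kernel_eq_mul μ hV (fun x => ⟨f x, hfV x⟩)
    (fun x y => by simp [hf, dist_comm]) (fun g x y => by simp [hf])
  have hcont : ∀ x : M, Continuous fun y => φ (dist y x) := fun x => by
    have : (fun y => φ (dist y x)) = fun y => (f x y).re := by
      ext y
      simp [hf]
    rw [this]
    exact Complex.continuous_re.comp (f x).continuous
  -- The scalar identity for the zonal function at `z`: the kernel reproduces itself up to `c`.
  have hconv : ∀ x z : M,
      ((∫ y, φ (dist y x) * φ (dist y z) ∂μ : ℝ) : ℂ) = c * (φ (dist x z) : ℝ) := by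
    intro x z
    rw [← hf, ← hc (f z) (hfV z) x, ← integral_complex_ofReal]
    simp [hf]
  obtain ⟨p⟩ : Nonempty M := nonempty_of_isProbabilityMeasure μ
  set l : ℝ := ∫ y, φ (dist y p) * φ (dist y p) ∂μ with hl
  have hcl : c = (l : ℂ) := by
    have := hconv p p
    rw [dist_self, h0] at this
    simpa using this.symm
  -- The integrand is continuous and equals `1` at `p`, and `μ` charges open sets.
  have hlpos : 0 < l :=
    ((hcont p).mul (hcont p)).integral_pos_of_hasCompactSupport_nonneg_nonzero
      (HasCompactSupport.of_compactSpace _) (fun y => mul_self_nonneg _) (x := p) (by simp [h0])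
  have hreal : ∀ x z : M, ∫ y, φ (dist y x) * φ (dist y z) ∂μ = l * φ (dist x z) := by
    intro x z
    have := hconv x z
    rw [hcl] at this
    exact_mod_cast this
  have hsum : l * ∑ x ∈ C, ∑ z ∈ C, φ (dist x z) =
      ∫ y, (∑ x ∈ C, φ (dist y x)) * (∑ x ∈ C, φ (dist y x)) ∂μ := by
    simp_rw [Finset.sum_mul_sum, Finset.mul_sum, ← hreal]
    have hc2 : ∀ x z : M, Continuous fun y => φ (dist y x) * φ (dist y z) := fun x z =>
      (hcont x).mul (hcont z)
    rw [integral_finsetSum _ fun x _ => integrable_of_continuous μ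
      (continuous_finsetSum _ fun z _ => hc2 x z)]
    exact Finset.sum_congr rfl fun x _ =>
      (integral_finsetSum _ fun z _ => integrable_of_continuous μ (hc2 x z)).symm
  refine nonneg_of_mul_nonneg_right ?_ hlpos
  rw [hsum]
  exact integral_nonneg fun y => mul_self_nonneg _

/-- The zonal polynomials of a 2-point-homogeneous space are positive semidefinite kernels. -/
theorem IsZonalFamily.sum_nonneg [IsIsometricSMul G M] (hM : TwoPointHomogeneous G M)
    {μ : Measure M} [IsProbabilityMeasure μ] [SMulInvariantMeasure G M μ] {F : ℝ → ℝ}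
    {Φ : ℕ → ℝ → ℝ} (hΦ : IsZonalFamily G μ F Φ) {k : ℕ} (hk : k ∈ zonalIndex M F)
    (C : Finset M) : 0 ≤ ∑ x ∈ C, ∑ y ∈ C, Φ k (tau F x y) := by
  obtain ⟨V, hV, -, -, hz, h1⟩ := hΦ
  have := (hV k hk).1
  exact sum_zonal_nonneg hM μ (hV k hk).2 (fun r => Φ k (F r)) (h1 k hk) (hz k hk) C

/-- The sum of a zonal function over pairs of distinct points of `C` is at least `-|C|`. -/
theorem IsZonalFamily.neg_card_le_sum_offDiag [DecidableEq M] [IsIsometricSMul G M]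
    (hM : TwoPointHomogeneous G M) {μ : Measure M} [IsProbabilityMeasure μ]
    [SMulInvariantMeasure G M μ] {F : ℝ → ℝ} {Φ : ℕ → ℝ → ℝ} (hΦ : IsZonalFamily G μ F Φ)
    {k : ℕ} (hk : k ∈ zonalIndex M F) (C : Finset M) :
    -(C.card : ℝ) ≤ ∑ p ∈ C.offDiag, Φ k (tau F p.1 p.2) := by
  have h := hΦ.sum_nonneg hM hk C
  obtain ⟨-, -, -, -, -, h1⟩ := hΦ
  rw [← Finset.sum_product', ← Finset.diag_union_offDiag,
    Finset.sum_union (Finset.disjoint_diag_offDiag C), Finset.sum_diag] at h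
  simp only [tau, dist_self, h1 k hk, Finset.sum_const, nsmul_eq_mul, mul_one] at h
  simp only [tau]
  linarith

end Kernel

/-! ### Moments and feasible points. -/

section Moments

theorem posSemidef_fromBlocks_diagonal {p q : Type*} [Fintype p] [Fintype q]
    {A : Matrix p p ℝ} {B : Matrix q q ℝ} (hA : A.PosSemidef) (hB : B.PosSemidef) :
    (Matrix.fromBlocks A 0 0 B).PosSemidef := by
  rw [Matrix.posSemidef_iff_dotProduct_mulVec] at hA hB ⊢
  refine ⟨Matrix.IsHermitian.fromBlocks hA.1 (by simp) hB.1, fun x => ?_⟩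
  have h : star x ⬝ᵥ (Matrix.fromBlocks A 0 0 B).mulVec x =
      star (x ∘ Sum.inl) ⬝ᵥ A.mulVec (x ∘ Sum.inl) +
        star (x ∘ Sum.inr) ⬝ᵥ B.mulVec (x ∘ Sum.inr) := by
    rw [Matrix.fromBlocks_mulVec]
    simp [dotProduct, Function.comp_def]
  rw [h]
  exact add_nonneg (hA.2 _) (hB.2 _)

/-- Hankel matrices of weighted power sums with nonnegative weights are positive semidefinite. -/
theorem posSemidef_hankel_of_weights {ι : Type*} (P : Finset ι) (w t : ι → ℝ)
    (hw : ∀ p ∈ P, 0 ≤ w p) (m : ℕ) (A : Matrix (Fin m) (Fin m) ℝ)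
    (hA : ∀ i j : Fin m, A i j = ∑ p ∈ P, w p * t p ^ (i + j : ℕ)) : A.PosSemidef := by
  have : A = ∑ p ∈ P, w p • Matrix.vecMulVec (fun i : Fin m => t p ^ (i : ℕ))
      (star fun i : Fin m => t p ^ (i : ℕ)) := by
    ext i j
    simp [hA, Matrix.sum_apply, Matrix.vecMulVec_apply, pow_add]
  rw [this]
  exact Matrix.posSemidef_sum _ fun p hp =>
    (Matrix.posSemidef_vecMulVec_self_star _).smul (hw p hp)

/-- The moments of a probability vector supported on `[a, b]` give a positive semidefinite
Sylvester matrix. -/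
theorem posSemidef_sylvesterH_of_weights {ι : Type*} (P : Finset ι) (w t : ι → ℝ)
    (hw : ∀ p ∈ P, 0 ≤ w p) {a b : ℝ} (ht : ∀ p ∈ P, t p ∈ Set.Icc a b) (m : ℕ) (s : ℕ → ℝ)
    (hs : ∀ d < 2 * m, s d = ∑ p ∈ P, w p * t p ^ d) : (sylvesterH m s a b).PosSemidef := by
  refine posSemidef_fromBlocks_diagonal ?_ (posSemidef_fromBlocks_diagonal ?_ ?_)
  · refine posSemidef_hankel_of_weights P w t hw m _ fun i j => ?_
    exact hs _ (by omega)
  -- The factor `t - a ≥ 0` is absorbed into the weights. The largest index is `2m - 1`, still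
  -- covered by `hs`.
  · refine posSemidef_hankel_of_weights P (fun p => w p * (t p - a)) t
      (fun p hp => mul_nonneg (hw p hp) (sub_nonneg.2 (ht p hp).1)) m _ fun i j => ?_
    rw [hankelPlus, Matrix.of_apply, hs _ (by omega), hs _ (by omega), Finset.mul_sum,
      ← Finset.sum_sub_distrib]
    exact Finset.sum_congr rfl fun p _ => by ring
  · refine posSemidef_hankel_of_weights P (fun p => w p * (b - t p)) t
      (fun p hp => mul_nonneg (hw p hp) (sub_nonneg.2 (ht p hp).2)) m _ fun i j => ?_
    rw [hankelMinus, Matrix.of_apply, hs _ (by omega), hs _ (by omega), Finset.mul_sum,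
      ← Finset.sum_sub_distrib]
    exact Finset.sum_congr rfl fun p _ => by ring

theorem powerSums_of_moments {m : ℕ} (s : ℕ → ℝ) (h0 : s 0 = 1) {d : ℕ} (hd : d < 2 * m) :
    powerSums (fun i : Fin (2 * m - 1) => s (i + 1)) d = s d := by
  unfold powerSums
  split_ifs with h h'
  · rw [h, h0]
  · simp only
    congr 1
    omega
  · omega

/-- Averages of `t ^ d` over a finite family in `[a, b]` form a feasible point. -/
theorem average_mem_SDP0Values {ι : Type*} (P : Finset ι) (hP : P.Nonempty) (t : ι → ℝ)
    {a b : ℝ} (ht : ∀ p ∈ P, t p ∈ Set.Icc a b) (J : Set ℕ) (Φ : ℕ → ℝ[X])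
    (hdeg : ∀ k ∈ J, (Φ k).natDegree = k) (m : ℕ) (y : ℝ)
    (hΦ : ∀ k ∈ J, -(y * P.card) ≤ ∑ p ∈ P, (Φ k).eval (t p)) :
    y ∈ SDP0Values J Φ a b m := by
  have hcard : (0 : ℝ) < P.card := by exact_mod_cast hP.card_pos
  set s : ℕ → ℝ := fun d => ∑ p ∈ P, (P.card : ℝ)⁻¹ * t p ^ d with hs
  have h0 : s 0 = 1 := by simp [hs, hcard.ne']
  refine ⟨fun i => s (i + 1), fun k hk hkJ => ?_, ?_⟩
  · rw [Finset.mem_Icc] at hk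
    have hsum : (Φ k).coeff 0 + ∑ i ∈ Finset.Icc 1 k,
        (Φ k).coeff i * powerSums (fun i : Fin (2 * m - 1) => s (i + 1)) i =
        (P.card : ℝ)⁻¹ * ∑ p ∈ P, (Φ k).eval (t p) := by
      -- As `i ≤ k ≤ 2m - 1`, the padding value `0` of `powerSums` is never met.
      have h1 : ∑ i ∈ Finset.Icc 1 k,
          (Φ k).coeff i * powerSums (fun i : Fin (2 * m - 1) => s (i + 1)) i =
          ∑ i ∈ Finset.Icc 1 k, (Φ k).coeff i * s i := by
        refine Finset.sum_congr rfl fun i hi => ?_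
        rw [Finset.mem_Icc] at hi
        rw [powerSums_of_moments s h0 (by omega)]
      have h2 : (Φ k).coeff 0 + ∑ i ∈ Finset.Icc 1 k, (Φ k).coeff i * s i =
          ∑ i ∈ Finset.range (k + 1), (Φ k).coeff i * s i := by
        rw [Finset.range_eq_Ico, Finset.sum_eq_sum_Ico_succ_bot (by omega), h0, mul_one]
        rfl
      rw [h1, h2]
      simp_rw [eval_eq_sum_range, hdeg k hkJ, hs, Finset.mul_sum]
      rw [Finset.sum_comm]
      exact Finset.sum_congr rfl fun p _ => Finset.sum_congr rfl fun i _ => by ring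
    have hle : -y ≤ (P.card : ℝ)⁻¹ * ∑ p ∈ P, (Φ k).eval (t p) := by
      rw [inv_mul_eq_div, le_div_iff₀ hcard]
      linarith [hΦ k hkJ]
    linarith
  · exact posSemidef_sylvesterH_of_weights P (fun _ => (P.card : ℝ)⁻¹) t
      (fun _ _ => inv_nonneg.2 hcard.le) ht m _ fun d hd => powerSums_of_moments s h0 hd

end Moments

/-- The bound of the semidefinite program for a single code. -/
theorem card_le_of_isCode {M G : Type*} [MetricSpace M] [CompactSpace M]
    [MeasurableSpace M] [BorelSpace M] [Group G] [MulAction G M] [IsIsometricSMul G M]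
    (hM : TwoPointHomogeneous G M) (μ : Measure M) [IsProbabilityMeasure μ]
    [SMulInvariantMeasure G M μ] (F : ℝ → ℝ) (Φ : ℕ → ℝ[X])
    (hdeg : ∀ k ∈ zonalIndex M F, (Φ k).natDegree = k)
    (hΦ : IsZonalFamily G μ F fun k t => (Φ k).eval t)
    {a b : ℝ} {m : ℕ} {ystar : ℝ}
    (hy : ystar ∈ lowerBounds (SDP0Values (zonalIndex M F) Φ a b m)) (hpos : 0 < ystar)
    (C : Finset M) (hC : IsCode F (tauSet M F ∩ Set.Icc a b) C) :
    (C.card : ℝ) ≤ (1 + ystar) / ystar := by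
  classical
  rw [le_div_iff₀ hpos]
  -- With at most one point there are no pairs to average, but the bound exceeds `1`.
  rcases le_or_gt C.card 1 with h | h
  · have : (C.card : ℝ) ≤ 1 := by exact_mod_cast h
    nlinarith
  · have hN : (1 : ℝ) < C.card := by exact_mod_cast h
    have hmem : ((C.card : ℝ) - 1)⁻¹ ∈ SDP0Values (zonalIndex M F) Φ a b m := by
      refine average_mem_SDP0Values C.offDiag
        (by
          obtain ⟨x, hx, y, hy, hxy⟩ := Finset.one_lt_card.1 h
          exact ⟨(x, y), Finset.mem_offDiag.2 ⟨hx, hy, hxy⟩⟩)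
        (fun p => tau F p.1 p.2) (fun p hp => ?_) _ Φ hdeg m _ fun k hk => ?_
      · rw [Finset.mem_offDiag] at hp
        exact (hC p.1 hp.1 p.2 hp.2.1 hp.2.2).2
      · refine le_trans (le_of_eq ?_) (hΦ.neg_card_le_sum_offDiag hM hk C)
        rw [Finset.offDiag_card, Nat.cast_sub (Nat.le_mul_self _), Nat.cast_mul]
        have : (C.card : ℝ) - 1 ≠ 0 := by linarith
        field_simp
    have h1 := hy hmem
    rw [le_inv_comm₀ hpos (by linarith), ← one_div, le_div_iff₀ hpos] at h1
    linarith

end ZonalSDP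

theorem theorem5p5 {M G : Type*} [MetricSpace M] [CompactSpace M]
    [MeasurableSpace M] [BorelSpace M] [Group G] [MulAction G M] [IsIsometricSMul G M]
    (hM : ZonalSDP.TwoPointHomogeneous G M)
    (μ : Measure M) [IsProbabilityMeasure μ] [SMulInvariantMeasure G M μ]
    (F : ℝ → ℝ) (Φ : ℕ → ℝ[X])
    (hdeg : ∀ k ∈ ZonalSDP.zonalIndex M F, (Φ k).natDegree = k)
    (hΦ : ZonalSDP.IsZonalFamily G μ F fun k t => (Φ k).eval t)
    (a b : ℝ) (m : ℕ) (hm : 1 ≤ m) (ystar : ℝ)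
    (hy : IsGLB (ZonalSDP.SDP0Values (ZonalSDP.zonalIndex M F) Φ a b m) ystar)
    (hpos : 0 < ystar) :
    (ZonalSDP.maxCode M F (ZonalSDP.tauSet M F ∩ Set.Icc a b) : ℝ≥0∞) ≤
      ENNReal.ofReal ((1 + ystar) / ystar) := by
  have hB : (0 : ℝ) ≤ (1 + ystar) / ystar := by positivity
  -- Bounding every code by the floor keeps the supremum in `ℕ∞` finite.
  have hle : ZonalSDP.maxCode M F (ZonalSDP.tauSet M F ∩ Set.Icc a b) ≤
      ((⌊(1 + ystar) / ystar⌋₊ : ℕ) : ℕ∞) :=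
    iSup₂_le fun C hC => by
      exact_mod_cast Nat.le_floor
        (ZonalSDP.card_le_of_isCode hM μ F Φ hdeg hΦ hy.1 hpos C hC)
  calc (ZonalSDP.maxCode M F (ZonalSDP.tauSet M F ∩ Set.Icc a b) : ℝ≥0∞)
      ≤ (((⌊(1 + ystar) / ystar⌋₊ : ℕ) : ℕ∞) : ℝ≥0∞) := by exact_mod_cast hle
    _ = ENNReal.ofReal (⌊(1 + ystar) / ystar⌋₊ : ℝ) := by simp
    _ ≤ ENNReal.ofReal ((1 + ystar) / ystar) := ENNReal.ofReal_le_ofReal (Nat.floor_le hB)
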